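/- An o-minimal structure on $(\mathbb R,+,\cdot)$ is a sequence $(\mathcal O_n)_{n\ge 0}$, where $\mathcal O_n$ is a Boolean algebra of subsets of $\mathbb R^n$, such that for every $n$: (i) if $A\in\mathcal O_n$, then $A\times\mathbb R$ and $\mathbb R\times A$ belong to $\mathcal O_{n+1}$; (ii) if $A\in\mathcal O_{n+1}$, then the projection of $A$ onto the first $n$ coordinates belongs to $\mathcal O_n$; (iii) $\{x\in\mathbb R^n : p(x)=0\}\in\mathcal O_n$ for every real polynomial $p$ in $n$ variables; (iv) the elements of $\mathcal O_1$ are exactly the finite unions of intervals and points. A subset of a finite-dimensional real vector space is definable in the structure if its image in $\mathbb R^n$ under linear coordinates belongs to $\mathcal O_n$ (this does not depend on the coordinates). For $\rho\in\mathbb R$, we say that $f$ belongs to $\mathrm{RV}^0_\rho$ when restricted to $(0,1]$ if $f|_{(0,1]}$ is Lebesgue measurable with values in $(0,\infty)$ and $\lim_{t\to0_+} f(\lambda t)/f(t)=\lambda^\rho$ for every $\lambda>0$. Let $\mathcal E$ be a finite-dimensional Euclidean space, let $m\ge 1$, and let $C_1,\dots,C_m\subseteq\mathcal E$ be closed convex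 sets, all definable in one and the same o-minimal structure, with $C:=\bigcap_{i=1}^m C_i\ne\emptyset$. Then there exists a consistent error bound function $\Phi$ for $C_1,\dots,C_m$, that is, a function $\Phi:[0,\infty)^2\to[0,\infty)$ that is nondecreasing in each variable and satisfies $\lim_{a\to0_+}\Phi(a,b)=\Phi(0,b)=0$ for all $b\ge0$ and $$\mathrm{dist}(x,C)\le\Phi\Big(\max_{1\le i\le m}\mathrm{dist}(x,C_i),\ \|x\|\Big)\qquad\text{for all }x\in\mathcal E,$$ such that for all sufficiently large $r>0$ there is $\rho\in[0,1]$ (possibly depending on $r$) such that $\Phi(\cdot,r)$ belongs to $\mathrm{RV}^0_\rho$ when restricted to $(0,1]$. In particular, for every bounded set $B\subseteq\mathcal E$ there exist $\rho\in[0,1]$ and a nondecreasing function $\psi_B:[0,\infty)\to[0,\infty)$ that belongs to $\mathrm{RV}^0_\rho$ when restricted to $(0,1]$ and satisfies $\lim_{t\to0_+}\psi_B(t)=0$ and $$\mathrm{dist}(x,C)\le\psi_B\Big(\max_{1\le i\le m}\mathrm{dist}(x,C_i)\Big)\qquad\text{for all }x\in B.$$ -/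

import Mathlib

open Set Filter Topology MeasureTheory

/-- An o-minimal structure on `(ℝ, +, ·)`: for every `n` a Boolean algebra `sets n` of subsets
of `ℝⁿ`, subject to the usual axioms. -/
structure OMinimalStructure where
  /-- The definable subsets of `ℝⁿ`. -/
  sets : (n : ℕ) → Set (Set (Fin n → ℝ))
  empty_mem : ∀ n : ℕ, (∅ : Set (Fin n → ℝ)) ∈ sets n
  compl_mem : ∀ (n : ℕ) (A : Set (Fin n → ℝ)), A ∈ sets n → Aᶜ ∈ sets n
  union_mem : ∀ (n : ℕ) (A B : Set (Fin n → ℝ)), A ∈ sets n → B ∈ sets n → A ∪ B ∈ sets n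
  /-- `A × ℝ` is definable. -/
  prod_real_mem : ∀ (n : ℕ) (A : Set (Fin n → ℝ)), A ∈ sets n →
    {x : Fin (n + 1) → ℝ | (fun i : Fin n => x i.castSucc) ∈ A} ∈ sets (n + 1)
  /-- `ℝ × A` is definable. -/
  real_prod_mem : ∀ (n : ℕ) (A : Set (Fin n → ℝ)), A ∈ sets n →
    {x : Fin (n + 1) → ℝ | (fun i : Fin n => x i.succ) ∈ A} ∈ sets (n + 1)
  /-- The projection of a definable set onto the first `n` coordinates is definable. -/
  proj_mem : ∀ (n : ℕ) (A : Set (Fin (n + 1) → ℝ)), A ∈ sets (n + 1) →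
    (fun (x : Fin (n + 1) → ℝ) (i : Fin n) => x i.castSucc) '' A ∈ sets n
  /-- The zero set of a polynomial is definable. -/
  algebraic_mem : ∀ (n : ℕ) (p : MvPolynomial (Fin n) ℝ),
    {x : Fin n → ℝ | MvPolynomial.eval x p = 0} ∈ sets n
  /-- The definable subsets of `ℝ` are exactly the finite unions of intervals and points: the
  order-connected subsets of `ℝ` are the intervals of all kinds, points and `∅` included. -/
  mem_one_iff : ∀ A : Set (Fin 1 → ℝ), A ∈ sets 1 ↔
    ∃ S : Set (Set ℝ), S.Finite ∧ (∀ I ∈ S, I.OrdConnected) ∧ A = {x | x 0 ∈ ⋃₀ S}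

/-- A subset of a finite-dimensional real vector space `E` is definable if it is so after `E` has
been identified with some `ℝⁿ` by linear coordinates. (Linear isomorphisms have algebraic graphs,
so that the choice of the coordinates is immaterial.) -/
def OMinimalStructure.Definable {E : Type*} [AddCommGroup E] [Module ℝ E]
    (O : OMinimalStructure) (A : Set E) : Prop :=
  ∃ (n : ℕ) (e : E ≃ₗ[ℝ] (Fin n → ℝ)), e '' A ∈ O.sets n

/-- The restriction of `f` to `(0, a]` is a (Lebesgue measurable) function into `(0, ∞)` that
is regularly varying at `0` with index `ρ`. -/
def RegularlyVaryingAtZero (f : ℝ → ℝ) (a ρ : ℝ) : Prop :=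
  0 < a ∧ (∀ t ∈ Ioc 0 a, 0 < f t) ∧ NullMeasurable f (volume.restrict (Ioc 0 a)) ∧
    ∀ l : ℝ, 0 < l → Tendsto (fun t : ℝ => f (l * t) / f t) (𝓝[>] 0) (𝓝 (l ^ ρ))

/-- `Φ`, as a function on `[0, ∞) × [0, ∞)`, is a consistent error bound function for the
sets `C i`. Its values at negative arguments are irrelevant. (For finitely many and at least one
set, the supremum below is the maximum.) -/
structure IsConsistentErrorBound {E : Type*} [NormedAddCommGroup E] {m : ℕ}
    (C : Fin m → Set E) (Φ : ℝ → ℝ → ℝ) : Prop where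
  nonneg : ∀ a b : ℝ, 0 ≤ a → 0 ≤ b → 0 ≤ Φ a b
  monotone_left : ∀ b : ℝ, 0 ≤ b → MonotoneOn (fun a => Φ a b) (Ici 0)
  monotone_right : ∀ a : ℝ, 0 ≤ a → MonotoneOn (fun b => Φ a b) (Ici 0)
  tendsto_zero : ∀ b : ℝ, 0 ≤ b → Tendsto (fun a => Φ a b) (𝓝[>] 0) (𝓝 0)
  zero_left : ∀ b : ℝ, 0 ≤ b → Φ 0 b = 0
  error_bound : ∀ x : E,
    Metric.infDist x (⋂ i, C i) ≤ Φ (⨆ i, Metric.infDist x (C i)) ‖x‖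

/-! Fix `c ∈ C`. The bound `errorModulus` is the worst distance to `C` over points of a ball about
`c` lying within `a` of every `C i`; the maximum with `a` keeps it positive even when that supremum
vanishes. Compactness makes it tend to `0` with `a`.

Write `F` for this function of `a`, the radius being fixed. Convexity gives `l * F t ≤ F (l * t)`
for `0 < l ≤ 1` (`mul_errorModulus_le`), so with monotonicity `F (l * t) / F t` stays between `min l
1` and `max l 1`. The region below the graph of `F` is definable, so by o-minimality each comparison
`k * F t ≤ F (l * t)` eventually holds or eventually fails as `t → 0+`
(`eventually_mul_errorModulus_le_or`). Hence the quotients converge; the limit is multiplicative in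
`l` and obeys the same bounds, so it is `l ^ ρ` with `ρ ∈ [0, 1]` (`exists_regularlyVaryingAtZero`).
-/

namespace OMinimalStructure

/-! ### Definable subsets of `ℝⁿ` -/

variable (O : OMinimalStructure)

theorem inter_mem {n : ℕ} {A B : Set (Fin n → ℝ)} (hA : A ∈ O.sets n) (hB : B ∈ O.sets n) :
    A ∩ B ∈ O.sets n := by
  have := O.compl_mem n _ (O.union_mem n _ _ (O.compl_mem n _ hA) (O.compl_mem n _ hB))
  rwa [compl_union, compl_compl, compl_compl] at this

theorem univ_mem (n : ℕ) : (univ : Set (Fin n → ℝ)) ∈ O.sets n := by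
  simpa using O.compl_mem n _ (O.empty_mem n)

theorem iInter_mem {n : ℕ} {ι : Type*} [Finite ι] {A : ι → Set (Fin n → ℝ)}
    (hA : ∀ i, A i ∈ O.sets n) : (⋂ i, A i) ∈ O.sets n := by
  classical
  have := Fintype.ofFinite ι
  have key : ∀ s : Finset ι, (⋂ i ∈ s, A i) ∈ O.sets n := by
    intro s
    induction s using Finset.induction_on with
    | empty => simpa using O.univ_mem n
    | insert a s _ ih =>
      rw [Finset.set_biInter_insert]
      exact O.inter_mem (hA a) ih
  simpa using key Finset.univ

theorem cast_mem {n m : ℕ} (h : n = m) {A : Set (Fin n → ℝ)} (hA : A ∈ O.sets n) :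
    {x : Fin m → ℝ | (fun i : Fin n => x (i.cast h)) ∈ A} ∈ O.sets m := by
  subst h
  exact hA

theorem addNat_mem {k : ℕ} {A : Set (Fin k → ℝ)} (hA : A ∈ O.sets k) (n : ℕ) :
    {x : Fin (k + n) → ℝ | (fun i : Fin k => x (i.addNat n)) ∈ A} ∈ O.sets (k + n) := by
  induction n with
  | zero => exact hA
  | succ n ih => exact O.real_prod_mem (k + n) _ ih

theorem natAdd_mem {k : ℕ} {A : Set (Fin k → ℝ)} (hA : A ∈ O.sets k) (n : ℕ) :
    {x : Fin (n + k) → ℝ | (fun i : Fin k => x (Fin.natAdd n i)) ∈ A} ∈ O.sets (n + k) := by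
  convert O.cast_mem (Nat.add_comm k n) (O.addNat_mem hA n) using 1
  ext x
  simp only [mem_ofPred_eq]
  congr! 3
  ext
  simp

theorem image_castAdd_mem {n k : ℕ} {A : Set (Fin (n + k) → ℝ)} (hA : A ∈ O.sets (n + k)) :
    (fun (x : Fin (n + k) → ℝ) (i : Fin n) => x (Fin.castAdd k i)) '' A ∈ O.sets n := by
  induction k with
  | zero => simpa using hA
  | succ k ih =>
    have := ih (O.proj_mem (n + k) A hA)
    rw [image_image] at this
    exact this

/-- The graph of a polynomial map is algebraic, and the preimage is the projection of its
intersection with `ℝⁿ × A`. -/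
theorem preimage_polynomial_mem {n k : ℕ} {A : Set (Fin k → ℝ)} (hA : A ∈ O.sets k)
    (p : Fin k → MvPolynomial (Fin n) ℝ) :
    {x : Fin n → ℝ | (fun i => MvPolynomial.eval x (p i)) ∈ A} ∈ O.sets n := by
  have hg := O.iInter_mem fun i : Fin k => O.algebraic_mem (n + k)
    (MvPolynomial.X (Fin.natAdd n i) - MvPolynomial.rename (Fin.castAdd k) (p i))
  convert O.image_castAdd_mem (O.inter_mem (O.natAdd_mem hA n) hg) using 1
  ext x
  simp only [mem_ofPred_eq, mem_image, mem_inter_iff, mem_iInter, map_sub, MvPolynomial.eval_X,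
    MvPolynomial.eval_rename, sub_eq_zero]
  constructor
  · intro h
    refine ⟨Fin.append x fun i => MvPolynomial.eval x (p i), ⟨by simpa using h, fun i => ?_⟩, ?_⟩
    · rw [Fin.append_right]
      congr 1
      congr 1
      ext j
      simp
    · ext j
      simp
  · rintro ⟨z, ⟨hz, he⟩, rfl⟩
    convert hz using 2 with i
    exact (he i).symm

theorem preimage_affine_mem {n k : ℕ} {A : Set (Fin k → ℝ)} (hA : A ∈ O.sets k)
    (L : (Fin n → ℝ) →ₗ[ℝ] (Fin k → ℝ)) (c : Fin k → ℝ) :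
    {x : Fin n → ℝ | L x + c ∈ A} ∈ O.sets n := by
  convert O.preimage_polynomial_mem hA fun i => ∑ j, MvPolynomial.X j *
    MvPolynomial.C (L (fun j' => if j = j' then 1 else 0) i) + MvPolynomial.C (c i) using 1
  ext x
  simp only [mem_ofPred_eq]
  congr! 1
  ext i
  have := congrFun (L.pi_apply_eq_sum_univ x) i
  simp only [Pi.add_apply, map_add, map_sum, map_mul, MvPolynomial.eval_X, MvPolynomial.eval_C]
  rw [this]
  simp

/-! ### Definability in finite-dimensional spaces -/

variable {O}
variable {V W : Type*} [AddCommGroup V] [Module ℝ V] [AddCommGroup W] [Module ℝ W]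

theorem definable_iff {A : Set V} {n : ℕ} (e : V ≃ₗ[ℝ] (Fin n → ℝ)) :
    O.Definable A ↔ e '' A ∈ O.sets n := by
  refine ⟨?_, fun h => ⟨n, e, h⟩⟩
  rintro ⟨k, e', h⟩
  obtain rfl : k = n := by
    simpa using (e'.symm.trans e).finrank_eq
  convert O.preimage_affine_mem h (e.symm.trans e').toLinearMap 0 using 1
  ext x
  simp [e.image_eq_preimage_symm, e'.image_eq_preimage_symm]

/-- Linear coordinates, in the form in which they are used to test definability. -/
theorem exists_coordinates (V : Type*) [AddCommGroup V] [Module ℝ V] [FiniteDimensional ℝ V] :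
    ∃ n : ℕ, Nonempty (V ≃ₗ[ℝ] (Fin n → ℝ)) :=
  ⟨_, ⟨(Module.finBasis ℝ V).equivFun⟩⟩

/-- The coordinates of a pair, those of the first component first. -/
noncomputable def prodCoordinates {n k : ℕ} (e : V ≃ₗ[ℝ] (Fin n → ℝ)) (f : W ≃ₗ[ℝ] (Fin k → ℝ)) :
    (V × W) ≃ₗ[ℝ] (Fin (n + k) → ℝ) :=
  ((e.prodCongr f).trans (LinearEquiv.sumArrowLequivProdArrow (Fin n) (Fin k) ℝ ℝ).symm).trans
    (LinearEquiv.funCongrLeft ℝ ℝ finSumFinEquiv.symm)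

@[simp]
theorem prodCoordinates_castAdd {n k : ℕ} (e : V ≃ₗ[ℝ] (Fin n → ℝ)) (f : W ≃ₗ[ℝ] (Fin k → ℝ))
    (z : V × W) (i : Fin n) : prodCoordinates e f z (Fin.castAdd k i) = e z.1 i := by
  simp [prodCoordinates, LinearEquiv.funCongrLeft, LinearMap.funLeft]

@[simp]
theorem prodCoordinates_natAdd {n k : ℕ} (e : V ≃ₗ[ℝ] (Fin n → ℝ)) (f : W ≃ₗ[ℝ] (Fin k → ℝ))
    (z : V × W) (i : Fin k) : prodCoordinates e f z (Fin.natAdd n i) = f z.2 i := by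
  simp [prodCoordinates, LinearEquiv.funCongrLeft, LinearMap.funLeft]

theorem Definable.exists_snd [FiniteDimensional ℝ V] [FiniteDimensional ℝ W] {A : Set (V × W)}
    (hA : O.Definable A) : O.Definable {v | ∃ w, (v, w) ∈ A} := by
  obtain ⟨n, ⟨e⟩⟩ := exists_coordinates V
  obtain ⟨k, ⟨f⟩⟩ := exists_coordinates W
  rw [definable_iff e]
  convert O.image_castAdd_mem ((definable_iff (prodCoordinates e f)).1 hA) using 1
  rw [image_image]
  ext x
  simp only [mem_image, mem_ofPred_eq, prodCoordinates_castAdd, Prod.exists]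
  constructor
  · rintro ⟨v, ⟨w, h⟩, rfl⟩
    exact ⟨v, w, h, rfl⟩
  · rintro ⟨v, w, h, rfl⟩
    exact ⟨v, ⟨w, h⟩, rfl⟩

theorem Definable.preimage_affine [FiniteDimensional ℝ V] {A : Set W} (hA : O.Definable A)
    (L : V →ₗ[ℝ] W) (c : W) : O.Definable {v | L v + c ∈ A} := by
  obtain ⟨n, ⟨e⟩⟩ := exists_coordinates V
  obtain ⟨k, f, h⟩ := hA
  rw [definable_iff e]
  convert O.preimage_affine_mem h (f.toLinearMap ∘ₗ L ∘ₗ e.symm.toLinearMap) (f c) using 1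
  ext x
  simp [e.image_eq_preimage_symm, f.image_eq_preimage_symm]

theorem Definable.preimage [FiniteDimensional ℝ V] {A : Set W} (hA : O.Definable A)
    (L : V →ₗ[ℝ] W) : O.Definable {v | L v ∈ A} := by
  simpa using hA.preimage_affine L 0

theorem Definable.compl {A : Set V} (hA : O.Definable A) : O.Definable Aᶜ := by
  obtain ⟨n, e, h⟩ := hA
  exact ⟨n, e, by rw [image_compl_eq e.bijective]; exact O.compl_mem _ _ h⟩

theorem Definable.inter {A B : Set V} (hA : O.Definable A) (hB : O.Definable B) :
    O.Definable (A ∩ B) := by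
  obtain ⟨n, e, h⟩ := hA
  exact ⟨n, e, by rw [image_inter e.injective]; exact O.inter_mem h ((definable_iff e).1 hB)⟩

theorem Definable.union {A B : Set V} (hA : O.Definable A) (hB : O.Definable B) :
    O.Definable (A ∪ B) := by
  obtain ⟨n, e, h⟩ := hA
  exact ⟨n, e, by rw [image_union]; exact O.union_mem _ _ _ h ((definable_iff e).1 hB)⟩

theorem Definable.iInter [FiniteDimensional ℝ V] {ι : Type*} [Finite ι] {A : ι → Set V}
    (hA : ∀ i, O.Definable (A i)) : O.Definable (⋂ i, A i) := by
  obtain ⟨n, ⟨e⟩⟩ := exists_coordinates V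
  refine ⟨n, e, ?_⟩
  rw [image_iInter e.bijective]
  exact O.iInter_mem fun i => (definable_iff e).1 (hA i)

variable (O) in
theorem definable_of_ordConnected {I : Set ℝ} (hI : I.OrdConnected) : O.Definable I := by
  refine ⟨1, (LinearEquiv.funUnique (Fin 1) ℝ ℝ).symm, (O.mem_one_iff _).2 ⟨{I}, by simp, by simpa, ?_⟩⟩
  rw [LinearEquiv.image_eq_preimage_symm]
  ext x
  simp

/-- An interval that meets every `(0, δ)` contains some `(0, δ)`, and only finitely many intervals
are involved. -/
theorem Definable.eventually_or {T : Set ℝ} (hT : O.Definable T) :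
    (∀ᶠ t in 𝓝[>] (0 : ℝ), t ∈ T) ∨ ∀ᶠ t in 𝓝[>] (0 : ℝ), t ∉ T := by
  obtain ⟨S, hS, hI, hTS⟩ :=
    (O.mem_one_iff _).1 ((definable_iff (LinearEquiv.funUnique (Fin 1) ℝ ℝ).symm).1 hT)
  have hT' : T = ⋃₀ S := by
    ext t
    have := Set.ext_iff.1 hTS fun _ => t
    rw [LinearEquiv.image_eq_preimage_symm] at this
    simpa using this
  subst hT'
  by_cases h : ∃ I ∈ S, ∃ᶠ t in 𝓝[>] (0 : ℝ), t ∈ I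
  · obtain ⟨I, hIS, hf⟩ := h
    left
    obtain ⟨t₀, h₀, h₀'⟩ := (hf.and_eventually self_mem_nhdsWithin).exists
    filter_upwards [Ioo_mem_nhdsGT h₀'] with t ht
    obtain ⟨t₁, h₁, h₁'⟩ := (hf.and_eventually (Ioo_mem_nhdsGT ht.1)).exists
    exact ⟨I, hIS, (hI I hIS).out h₁ h₀ ⟨h₁'.2.le, ht.2.le⟩⟩
  · right
    push Not at h
    have := (Set.Finite.eventually_all hS).2 h
    filter_upwards [this] with t ht
    rintro ⟨I, hIS, hti⟩
    exact ht I hIS hti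

variable (O) in
theorem definable_norm_le (E : Type*) [NormedAddCommGroup E] [InnerProductSpace ℝ E]
    [FiniteDimensional ℝ E] : O.Definable {z : E × ℝ | ‖z.1‖ ≤ z.2} := by
  set b := stdOrthonormalBasis ℝ E
  set d := Module.finrank ℝ E
  set e : E ≃ₗ[ℝ] (Fin d → ℝ) := b.toBasis.equivFun
  set f : ℝ ≃ₗ[ℝ] (Fin 1 → ℝ) := (LinearEquiv.funUnique (Fin 1) ℝ ℝ).symm
  have hnn := (definable_iff f).1 (O.definable_of_ordConnected (ordConnected_Ici (a := (0 : ℝ))))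
  have h1 : O.Definable {z : E × ℝ | 0 ≤ z.2} :=
    (O.definable_of_ordConnected (ordConnected_Ici (a := (0 : ℝ)))).preimage (LinearMap.snd ℝ E ℝ)
  -- Orthonormal coordinates turn the squared norm into a polynomial.
  have h2 : O.Definable {z : E × ℝ | ‖z.1‖ ^ 2 ≤ z.2 ^ 2} := by
    rw [definable_iff (prodCoordinates e f)]
    convert O.preimage_polynomial_mem hnn fun _ : Fin 1 =>
      MvPolynomial.X (Fin.natAdd d 0) ^ 2 - ∑ i, MvPolynomial.X (Fin.castAdd 1 i) ^ 2 using 1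
    ext x
    obtain ⟨z, rfl⟩ := (prodCoordinates e f).surjective x
    rw [(prodCoordinates e f).injective.mem_set_image, LinearEquiv.image_eq_preimage_symm]
    have hn : ‖z.1‖ ^ 2 = ∑ i, (e z.1 i) ^ 2 := by
      rw [← b.sum_sq_norm_inner_right]
      simp [e, b.repr_apply_apply]
    simp [hn, f]
  convert h1.inter h2 using 1
  ext z
  exact ⟨fun h => ⟨(norm_nonneg _).trans h, pow_le_pow_left₀ (norm_nonneg _) h 2⟩,
    fun h => (sq_le_sq₀ (norm_nonneg _) h.1).1 h.2⟩

end OMinimalStructure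

/-! ### Regular variation from non-oscillating quotients -/

/-- A function squeezed between a nondecreasing and a linear growth condition is regularly varying
at `0` as soon as its quotients do not oscillate there. -/
theorem exists_regularlyVaryingAtZero {F : ℝ → ℝ} (hpos : ∀ t, 0 < t → 0 < F t)
    (hmono : MonotoneOn F (Ioi 0)) (hlin : ∀ t l, 0 < t → 0 < l → l ≤ 1 → l * F t ≤ F (l * t))
    (hosc : ∀ l c : ℝ, 0 < l → 0 < c → (∀ᶠ t in 𝓝[>] (0 : ℝ), c * F t ≤ F (l * t)) ∨
      ∀ᶠ t in 𝓝[>] (0 : ℝ), ¬ c * F t ≤ F (l * t)) :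
    ∃ ρ ∈ Icc (0 : ℝ) 1, RegularlyVaryingAtZero F 1 ρ := by
  have hgt : ∀ᶠ t in 𝓝[>] (0 : ℝ), 0 < t := self_mem_nhdsWithin
  have hbig : ∀ t l, 0 < t → 1 ≤ l → 1 ≤ F (l * t) / F t ∧ F (l * t) / F t ≤ l := by
    intro t l ht hl
    have hl0 : 0 < l := one_pos.trans_le hl
    rw [le_div_iff₀ (hpos t ht), div_le_iff₀ (hpos t ht), one_mul]
    refine ⟨hmono ht (mul_pos hl0 ht) (le_mul_of_one_le_left ht.le hl), ?_⟩
    have := hlin (l * t) l⁻¹ (mul_pos hl0 ht) (inv_pos.2 hl0) (inv_le_one_of_one_le₀ hl)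
    rwa [inv_mul_cancel_left₀ hl0.ne', inv_mul_le_iff₀ hl0] at this
  have hsmall : ∀ t l, 0 < t → 0 < l → l ≤ 1 → l ≤ F (l * t) / F t ∧ F (l * t) / F t ≤ 1 := by
    intro t l ht hl hl1
    rw [le_div_iff₀ (hpos t ht), div_le_iff₀ (hpos t ht), one_mul]
    exact ⟨hlin t l ht hl hl1, hmono (mul_pos hl ht) ht (mul_le_of_le_one_left ht.le hl1)⟩
  have hbd : ∀ t l, 0 < t → 0 < l →
      min l 1 ≤ F (l * t) / F t ∧ F (l * t) / F t ≤ max l 1 := by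
    intro t l ht hl
    rcases le_total l 1 with h | h
    · simpa [h] using hsmall t l ht hl h
    · simpa [h] using hbig t l ht h
  have hlim : ∀ l, 0 < l → ∃ g, Tendsto (fun t => F (l * t) / F t) (𝓝[>] 0) (𝓝 g) := by
    intro l hl
    refine tendsto_of_no_upcrossings dense_univ ?_ ?_ ?_
    -- Quotients frequently below `a` and frequently above `b > a` would contradict the dichotomy
    -- `hosc` at the constant `b`.
    · rintro a - b - hab ⟨h1, h2⟩
      obtain ⟨t, hta, ht⟩ := (h1.and_eventually hgt).exists
      have hb : 0 < b :=
        ((div_pos (hpos _ (mul_pos hl ht)) (hpos t ht)).trans hta).trans hab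
      rcases hosc l b hl hb with h | h
      · obtain ⟨t, hta, ht, hc⟩ := (h1.and_eventually (hgt.and h)).exists
        rw [← le_div_iff₀ (hpos t ht)] at hc
        linarith
      · obtain ⟨t, hta, ht, hc⟩ := (h2.and_eventually (hgt.and h)).exists
        rw [← le_div_iff₀ (hpos t ht)] at hc
        exact hc hta.le
    · exact isBoundedUnder_of_eventually_le (hgt.mono fun t ht => (hbd t l ht hl).2)
    · exact isBoundedUnder_of_eventually_ge (hgt.mono fun t ht => (hbd t l ht hl).1)
  choose! g hg using hlim
  have hmem : ∀ l, 0 < l → min l 1 ≤ g l ∧ g l ≤ max l 1 := fun l hl =>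
    ⟨ge_of_tendsto (hg l hl) (hgt.mono fun t ht => (hbd t l ht hl).1),
      le_of_tendsto (hg l hl) (hgt.mono fun t ht => (hbd t l ht hl).2)⟩
  have hgpos : ∀ l, 0 < l → 0 < g l := fun l hl => (lt_min hl one_pos).trans_le (hmem l hl).1
  have hmul : ∀ l k, 0 < l → 0 < k → g (l * k) = g l * g k := by
    intro l k hl hk
    have hk0 : Tendsto (fun t : ℝ => k * t) (𝓝[>] 0) (𝓝[>] 0) := by
      refine tendsto_nhdsWithin_iff.2 ⟨?_, hgt.mono fun t ht => mul_pos hk ht⟩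
      have : Tendsto (fun t : ℝ => k * t) (𝓝 0) (𝓝 (k * 0)) := tendsto_id.const_mul k
      rw [mul_zero] at this
      exact this.mono_left nhdsWithin_le_nhds
    refine tendsto_nhds_unique (hg _ (mul_pos hl hk))
      ((((hg l hl).comp hk0).mul (hg k hk)).congr' ?_)
    filter_upwards [hgt] with t ht
    have h1 := (hpos t ht).ne'
    have h2 := (hpos _ (mul_pos hk ht)).ne'
    simp only [Function.comp_apply, mul_assoc]
    field_simp
  -- Cauchy's functional equation in logarithmic form: the bounds on `g` give `|G x| ≤ |x|`, so `G`
  -- is continuous, hence linear, and `ρ = G 1`.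
  let G : ℝ →+ ℝ := AddMonoidHom.mk' (fun x => Real.log (g (Real.exp x))) (by
    intro x y
    rw [Real.exp_add, hmul _ _ (Real.exp_pos x) (Real.exp_pos y),
      Real.log_mul (hgpos _ (Real.exp_pos x)).ne' (hgpos _ (Real.exp_pos y)).ne'])
  have hG : ∀ x, G x = Real.log (g (Real.exp x)) := fun _ => rfl
  have hGmem : ∀ x, min x 0 ≤ G x ∧ G x ≤ max x 0 := by
    intro x
    have hm : Monotone Real.exp := Real.exp_monotone
    obtain ⟨h1, h2⟩ := hmem _ (Real.exp_pos x)
    rw [← Real.exp_zero, ← hm.map_min] at h1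
    rw [← Real.exp_zero, ← hm.map_max] at h2
    rw [hG]
    exact ⟨(Real.le_log_iff_exp_le (hgpos _ (Real.exp_pos x))).2 h1,
      (Real.log_le_iff_le_exp (hgpos _ (Real.exp_pos x))).2 h2⟩
  have hcont : Continuous G := by
    refine AddMonoidHomClass.continuous_of_bound G 1 fun x => ?_
    rw [one_mul, Real.norm_eq_abs, Real.norm_eq_abs, abs_le]
    obtain ⟨h1, h2⟩ := hGmem x
    exact ⟨(le_min (neg_abs_le x) (by simp)).trans h1, h2.trans (max_le (le_abs_self x) (abs_nonneg x))⟩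
  have hlinG : ∀ x, G x = x * G 1 := fun x => by
    have := map_real_smul G hcont x 1
    simpa using this
  refine ⟨G 1, by simpa using hGmem 1, one_pos, fun t ht => hpos t ht.1, ?_, ?_⟩
  · exact (aemeasurable_restrict_of_monotoneOn measurableSet_Ioc
      (hmono.mono Ioc_subset_Ioi_self)).nullMeasurable
  · intro l hl
    convert hg l hl using 2
    have h := hlinG (Real.log l)
    rw [hG, Real.exp_log hl] at h
    rw [Real.rpow_def_of_pos hl, ← h, Real.exp_log (hgpos l hl)]

/-! ### The error modulus and its limit at zero -/

section ErrorModulus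

variable {E : Type*} [NormedAddCommGroup E] {m : ℕ}

/-- The points of a ball around `c` whose distance to each `C i` is at most `a`. The ball contains
that of radius `b` around the origin. -/
def nearlyFeasible (C : Fin m → Set E) (c : E) (a b : ℝ) : Set E :=
  {x | ‖x - c‖ ≤ b + ‖c‖ ∧ ∀ i, Metric.infDist x (C i) ≤ a}

/-- The largest distance to `⋂ i, C i` of a nearly feasible point, or `a` if this is larger. -/
noncomputable def errorModulus (C : Fin m → Set E) (c : E) (a b : ℝ) : ℝ :=
  max a (sSup ((fun x => Metric.infDist x (⋂ i, C i)) '' nearlyFeasible C c a b))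

variable {C : Fin m → Set E} {c : E} {a b : ℝ}

theorem nearlyFeasible_mono {a' b' : ℝ} (ha : a ≤ a') (hb : b ≤ b') :
    nearlyFeasible C c a b ⊆ nearlyFeasible C c a' b' :=
  fun _ hx => ⟨hx.1.trans (by linarith), fun i => (hx.2 i).trans ha⟩

theorem self_mem_nearlyFeasible (hc : c ∈ ⋂ i, C i) (ha : 0 ≤ a) (hb : 0 ≤ b) :
    c ∈ nearlyFeasible C c a b := by
  refine ⟨by simpa using add_nonneg hb (norm_nonneg c), fun i => ?_⟩
  rwa [Metric.infDist_zero_of_mem (mem_iInter.1 hc i)]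

theorem bddAbove_nearlyFeasible (hc : c ∈ ⋂ i, C i) :
    BddAbove ((fun x => Metric.infDist x (⋂ i, C i)) '' nearlyFeasible C c a b) := by
  refine ⟨b + ‖c‖, ?_⟩
  rintro _ ⟨x, hx, rfl⟩
  exact (Metric.infDist_le_dist_of_mem hc).trans (by rw [dist_eq_norm]; exact hx.1)

theorem le_errorModulus : a ≤ errorModulus C c a b := le_max_left _ _

theorem infDist_le_errorModulus (hc : c ∈ ⋂ i, C i) {x : E} (hx : x ∈ nearlyFeasible C c a b) :
    Metric.infDist x (⋂ i, C i) ≤ errorModulus C c a b :=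
  (le_csSup (bddAbove_nearlyFeasible hc) (mem_image_of_mem _ hx)).trans (le_max_right _ _)

theorem errorModulus_le (hc : c ∈ ⋂ i, C i) (ha : 0 ≤ a) (hb : 0 ≤ b) {s : ℝ} (hs : a ≤ s)
    (h : ∀ x ∈ nearlyFeasible C c a b, Metric.infDist x (⋂ i, C i) ≤ s) :
    errorModulus C c a b ≤ s := by
  refine max_le hs (csSup_le ⟨_, mem_image_of_mem _ (self_mem_nearlyFeasible hc ha hb)⟩ ?_)
  rintro _ ⟨x, hx, rfl⟩
  exact h x hx

theorem errorModulus_mono (hc : c ∈ ⋂ i, C i) (ha : 0 ≤ a) (hb : 0 ≤ b) {a' b' : ℝ} (haa : a ≤ a')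
    (hbb : b ≤ b') : errorModulus C c a b ≤ errorModulus C c a' b' :=
  errorModulus_le hc ha hb (haa.trans le_errorModulus) fun _ hx =>
    infDist_le_errorModulus hc (nearlyFeasible_mono haa hbb hx)

theorem errorModulus_zero (hC : ∀ i, IsClosed (C i)) (hc : c ∈ ⋂ i, C i) (hb : 0 ≤ b) :
    errorModulus C c 0 b = 0 := by
  refine le_antisymm (errorModulus_le hc le_rfl hb le_rfl fun x hx => ?_) le_errorModulus
  refine (Metric.infDist_zero_of_mem (mem_iInter.2 fun i => ?_)).le
  rw [(hC i).mem_iff_infDist_zero ⟨c, mem_iInter.1 hc i⟩]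
  exact le_antisymm (hx.2 i) Metric.infDist_nonneg

theorem bddAbove_range_infDist (C : Fin m → Set E) (x : E) :
    BddAbove (range fun i => Metric.infDist x (C i)) := (finite_range _).bddAbove

theorem mem_nearlyFeasible_iSup (x : E) :
    x ∈ nearlyFeasible C c (⨆ i, Metric.infDist x (C i)) ‖x‖ :=
  ⟨norm_sub_le x c, fun i => le_ciSup (bddAbove_range_infDist C x) i⟩

theorem tendsto_errorModulus [ProperSpace E] (hC : ∀ i, IsClosed (C i)) (hc : c ∈ ⋂ i, C i)
    (hb : 0 ≤ b) : Tendsto (fun a => errorModulus C c a b) (𝓝[>] 0) (𝓝 0) := by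
  have hgt : ∀ᶠ t in 𝓝[>] (0 : ℝ), 0 < t := self_mem_nhdsWithin
  rw [Metric.tendsto_nhds]
  intro ε hε
  suffices h : ∃ δ > 0, ∀ x, ‖x - c‖ ≤ b + ‖c‖ → (∀ i, Metric.infDist x (C i) < δ) →
      Metric.infDist x (⋂ i, C i) < ε / 2 by
    obtain ⟨δ, hδ, h⟩ := h
    filter_upwards [hgt, Ioo_mem_nhdsGT hδ, Ioo_mem_nhdsGT (half_pos hε)] with t ht htδ hte
    rw [Real.dist_eq, sub_zero, abs_of_nonneg (ht.le.trans le_errorModulus)]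
    refine (errorModulus_le hc ht.le hb hte.2.le fun x hx => ?_).trans_lt (half_lt_self hε)
    exact (h x hx.1 fun i => (hx.2 i).trans_lt htδ.2).le
  -- On the compact set of points of the ball far from `C`, the sum of the distances to the `C i`
  -- has a positive minimum.
  set K : Set E := Metric.closedBall c (b + ‖c‖) ∩ {x | ε / 2 ≤ Metric.infDist x (⋂ i, C i)}
  have hK : IsCompact K := (isCompact_closedBall _ _).inter_right
    (isClosed_le continuous_const (Metric.continuous_infDist_pt _))
  rcases K.eq_empty_or_nonempty with hKe | hKn
  · refine ⟨1, one_pos, fun x hx _ => ?_⟩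
    by_contra hcon
    exact (hKe.subset (show x ∈ K from ⟨by rwa [mem_closedBall_iff_norm], not_lt.1 hcon⟩)).elim
  · obtain ⟨x₀, hx₀, hmin⟩ := hK.exists_isMinOn hKn
      (f := fun x => ∑ i, Metric.infDist x (C i))
      (continuous_finsetSum _ fun i _ => Metric.continuous_infDist_pt _).continuousOn
    have hpos : 0 < ∑ i, Metric.infDist x₀ (C i) := by
      refine (Finset.sum_nonneg fun i _ => Metric.infDist_nonneg).lt_of_ne fun h => ?_
      have h0 := (Finset.sum_eq_zero_iff_of_nonneg fun i _ => Metric.infDist_nonneg).1 h.symm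
      have : x₀ ∈ ⋂ i, C i := mem_iInter.2 fun i =>
        ((hC i).mem_iff_infDist_zero ⟨c, mem_iInter.1 hc i⟩).2 (h0 i (Finset.mem_univ i))
      have h1 : ε / 2 ≤ Metric.infDist x₀ (⋂ i, C i) := hx₀.2
      rw [Metric.infDist_zero_of_mem this] at h1
      linarith
    -- With `m + 1`, not `m`, the `m` summands total strictly less than the minimum.
    refine ⟨(∑ i, Metric.infDist x₀ (C i)) / (m + 1), by positivity, fun x hx hlt => ?_⟩
    by_contra hcon
    have h1 := isMinOn_iff.1 hmin x ⟨by rwa [mem_closedBall_iff_norm], not_lt.1 hcon⟩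
    have h2 := Finset.sum_le_sum fun i (_ : i ∈ Finset.univ) => (hlt i).le
    rw [Finset.sum_const, Finset.card_univ, Fintype.card_fin, nsmul_eq_mul, ← mul_div_assoc,
      le_div_iff₀ (by positivity)] at h2
    nlinarith

/-- Trades the supremum for an existential quantifier, which definability can handle. -/
theorem lt_errorModulus_iff (hc : c ∈ ⋂ i, C i) (ha : 0 ≤ a) (hb : 0 ≤ b) {s : ℝ} :
    s < errorModulus C c a b ↔
      s < a ∨ ∃ x ∈ nearlyFeasible C c a b, s < Metric.infDist x (⋂ i, C i) := by
  rw [errorModulus, lt_max_iff, lt_csSup_iff (bddAbove_nearlyFeasible hc)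
    ⟨_, mem_image_of_mem _ (self_mem_nearlyFeasible hc ha hb)⟩, exists_mem_image]

theorem IsClosed.infDist_le_iff [ProperSpace E] {A : Set E} (hA : IsClosed A) (hne : A.Nonempty)
    {x : E} {t : ℝ} : Metric.infDist x A ≤ t ↔ ∃ y ∈ A, ‖x - y‖ ≤ t := by
  constructor
  · intro h
    obtain ⟨y, hy, he⟩ := hA.exists_infDist_eq_dist hne x
    exact ⟨y, hy, by rwa [← dist_eq_norm, ← he]⟩
  · rintro ⟨y, hy, h⟩
    exact (Metric.infDist_le_dist_of_mem hy).trans (by rwa [dist_eq_norm])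

end ErrorModulus

/-! ### Convexity and definability of the error modulus -/

section Inner

variable {E : Type*} [NormedAddCommGroup E] [InnerProductSpace ℝ E] [FiniteDimensional ℝ E] {m : ℕ}

/-- The nearest point of a closed convex set is no further from a point of the set. -/
theorem exists_infDist_eq_norm_sub_le {A : Set E} (hA : IsClosed A) (hconv : Convex ℝ A) {c : E}
    (hc : c ∈ A) (x : E) : ∃ p ∈ A, Metric.infDist x A = ‖x - p‖ ∧ ‖p - c‖ ≤ ‖x - c‖ := by
  obtain ⟨p, hp, he⟩ := exists_norm_eq_iInf_of_complete_convex ⟨c, hc⟩ hA.isComplete hconv x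
  refine ⟨p, hp, ?_, ?_⟩
  · rw [he, Metric.infDist_eq_iInf]
    simp [dist_eq_norm]
  -- The angle at the projection `p` is not acute, so `‖x - p‖² + ‖p - c‖² ≤ ‖x - c‖²`.
  · have h := (norm_eq_iInf_iff_real_inner_le_zero hconv hp).1 he c hc
    have h1 := norm_add_sq_real (x - p) (p - c)
    rw [sub_add_sub_cancel] at h1
    rw [← neg_sub p c, inner_neg_right] at h
    exact (sq_le_sq₀ (norm_nonneg _) (norm_nonneg _)).1 (by nlinarith [sq_nonneg ‖x - p‖])

theorem Convex.infDist_lineMap_le {A : Set E} (hA : IsClosed A) (hconv : Convex ℝ A) {p : E}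
    (hp : p ∈ A) (x : E) {l : ℝ} (h0 : 0 ≤ l) (h1 : l ≤ 1) :
    Metric.infDist (AffineMap.lineMap p x l) A ≤ l * Metric.infDist x A := by
  obtain ⟨y, hy, he⟩ := hA.exists_infDist_eq_dist ⟨p, hp⟩ x
  refine (Metric.infDist_le_dist_of_mem (hconv.lineMap_mem hp hy ⟨h0, h1⟩)).trans_eq ?_
  rw [he, dist_eq_norm, dist_eq_norm, AffineMap.lineMap_apply_module, AffineMap.lineMap_apply_module,
    add_sub_add_left_eq_sub, ← smul_sub, norm_smul, Real.norm_of_nonneg h0]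

/-- Shrink `x` by the factor `l` towards its projection `p` on `C`. As `p` lies in every `C i`,
those distances shrink at least by `l`, while the distance to `C` keeps at least the fraction `l`.
Centring the ball at a point of `C` keeps `p`, hence the segment, inside it. -/
theorem mul_errorModulus_le {C : Fin m → Set E} {c : E} {a b l : ℝ} (hC : ∀ i, IsClosed (C i))
    (hconv : ∀ i, Convex ℝ (C i)) (hc : c ∈ ⋂ i, C i) (ha : 0 < a) (hb : 0 ≤ b) (hl : 0 < l)
    (hl1 : l ≤ 1) : l * errorModulus C c a b ≤ errorModulus C c (l * a) b := by
  rw [← le_div_iff₀' hl]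
  refine errorModulus_le hc ha.le hb ?_ fun x hx => ?_
  · rw [le_div_iff₀' hl]
    exact le_errorModulus
  rw [le_div_iff₀' hl]
  obtain ⟨p, hp, hpx, hpc⟩ := exists_infDist_eq_norm_sub_le (isClosed_iInter hC)
    (convex_iInter hconv) hc x
  have hmem : AffineMap.lineMap p x l ∈ nearlyFeasible C c (l * a) b := by
    refine ⟨?_, fun i => ?_⟩
    · have := (convex_closedBall c ‖x - c‖).lineMap_mem (mem_closedBall_iff_norm.2 hpc)
        (mem_closedBall_iff_norm.2 le_rfl) ⟨hl.le, hl1⟩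
      exact (mem_closedBall_iff_norm.1 this).trans hx.1
    · exact ((hconv i).infDist_lineMap_le (hC i) (mem_iInter.1 hp i) x hl.le hl1).trans
        (mul_le_mul_of_nonneg_left (hx.2 i) hl.le)
  refine le_trans ?_ (infDist_le_errorModulus hc hmem)
  have h := Metric.infDist_le_infDist_add_dist (s := ⋂ i, C i) (x := x)
    (y := AffineMap.lineMap p x l)
  rw [dist_right_lineMap, dist_comm, dist_eq_norm, Real.norm_of_nonneg (by linarith)] at h
  rw [← hpx] at h
  linarith

variable {O : OMinimalStructure}

/-- For `r = b + ‖c‖` and `v.1 ≥ 0` this is the region strictly below the graph of the modulus.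
Distances are expressed by existential quantifiers, that is, by projections. -/
theorem OMinimalStructure.Definable.errorHypograph {C : Fin m → Set E}
    (hdef : ∀ i, O.Definable (C i)) (c : E) (r : ℝ) :
    O.Definable {v : ℝ × ℝ | v.2 < v.1 ∨ ∃ x : E, ‖x - c‖ ≤ r ∧ (∀ i, ∃ y ∈ C i, ‖x - y‖ ≤ v.1) ∧
      ¬ ∃ z ∈ ⋂ i, C i, ‖x - z‖ ≤ v.2} := by
  have hN := O.definable_norm_le E
  have hlt : O.Definable {v : ℝ × ℝ | v.2 < v.1} := by
    convert (O.definable_of_ordConnected (ordConnected_Iio (a := (0 : ℝ)))).preimage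
      (LinearMap.snd ℝ ℝ ℝ - LinearMap.fst ℝ ℝ ℝ) using 1
    ext v
    simp
  have hball : O.Definable {v : (ℝ × ℝ) × E | ‖v.2 - c‖ ≤ r} := by
    convert hN.preimage_affine ((LinearMap.snd ℝ (ℝ × ℝ) E).prod 0) (-c, r) using 1
    ext v
    simp [sub_eq_add_neg]
  have hnear {A : Set E} (hA : O.Definable A) (L : ℝ × ℝ →ₗ[ℝ] ℝ) :
      O.Definable {v : (ℝ × ℝ) × E | ∃ y ∈ A, ‖v.2 - y‖ ≤ L v.1} := by
    have h1 := hA.preimage (LinearMap.snd ℝ ((ℝ × ℝ) × E) E)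
    have h2 := hN.preimage ((LinearMap.snd ℝ (ℝ × ℝ) E ∘ₗ LinearMap.fst ℝ ((ℝ × ℝ) × E) E
      - LinearMap.snd ℝ ((ℝ × ℝ) × E) E).prod
      (L ∘ₗ LinearMap.fst ℝ (ℝ × ℝ) E ∘ₗ LinearMap.fst ℝ ((ℝ × ℝ) × E) E))
    exact (h1.inter h2).exists_snd
  have hall := OMinimalStructure.Definable.iInter fun i => hnear (hdef i) (LinearMap.fst ℝ ℝ ℝ)
  have hC := (hnear (OMinimalStructure.Definable.iInter hdef) (LinearMap.snd ℝ ℝ ℝ)).compl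
  convert hlt.union (hball.inter (hall.inter hC)).exists_snd using 1
  ext v
  simp

theorem eventually_mul_errorModulus_le_or {C : Fin m → Set E} (hdef : ∀ i, O.Definable (C i))
    (hC : ∀ i, IsClosed (C i)) {c : E} (hc : c ∈ ⋂ i, C i) {b l k : ℝ} (hb : 0 ≤ b) (hl : 0 < l)
    (hk : 0 < k) :
    (∀ᶠ t in 𝓝[>] (0 : ℝ), k * errorModulus C c t b ≤ errorModulus C c (l * t) b) ∨
      ∀ᶠ t in 𝓝[>] (0 : ℝ), ¬ k * errorModulus C c t b ≤ errorModulus C c (l * t) b := by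
  have hD := OMinimalStructure.Definable.errorHypograph hdef c (b + ‖c‖)
  set D := {v : ℝ × ℝ | v.2 < v.1 ∨ ∃ x : E, ‖x - c‖ ≤ b + ‖c‖ ∧
    (∀ i, ∃ y ∈ C i, ‖x - y‖ ≤ v.1) ∧ ¬ ∃ z ∈ ⋂ i, C i, ‖x - z‖ ≤ v.2}
  have hDiff : ∀ t s, 0 ≤ t → ((t, s) ∈ D ↔ s < errorModulus C c t b) := by
    intro t s ht
    rw [lt_errorModulus_iff hc ht hb]
    refine or_congr Iff.rfl (exists_congr fun x => ?_)
    rw [← (isClosed_iInter hC).infDist_le_iff ⟨c, hc⟩, not_le, ← and_assoc]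
    refine and_congr_left' (and_congr_right' (forall_congr' fun i => ?_))
    rw [(hC i).infDist_le_iff ⟨c, mem_iInter.1 hc i⟩]
  -- The comparison fails at `t > 0` exactly when some `s` has `(t, s) ∈ D` but `(l * t, k * s) ∉
  -- D`.
  have hT := (hD.inter (hD.preimage ((l • LinearMap.fst ℝ ℝ ℝ).prod
    (k • LinearMap.snd ℝ ℝ ℝ))).compl).exists_snd.compl
  refine hT.eventually_or.imp (fun h => ?_) fun h => ?_ <;>
    filter_upwards [h, self_mem_nhdsWithin] with t ht ht0
  all_goals
    have ht0 : 0 < t := ht0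
    have key : (¬ ∃ s, s < errorModulus C c t b ∧ ¬ k * s < errorModulus C c (l * t) b) ↔
        k * errorModulus C c t b ≤ errorModulus C c (l * t) b := by
      simp_rw [not_exists, not_and, not_not, ← lt_div_iff₀' hk, ← le_div_iff₀' hk]
      exact ⟨le_of_forall_lt, fun h s hs => hs.trans_le h⟩
    rw [← key]
    simpa [hDiff t _ ht0.le, hDiff (l * t) _ (mul_pos hl ht0).le] using ht

end Inner

/-! ### The consistent error bound and the main theorem -/

theorem isConsistentErrorBound_errorModulus {E : Type*} [NormedAddCommGroup E] [ProperSpace E]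
    {m : ℕ} {C : Fin m → Set E} (hC : ∀ i, IsClosed (C i)) {c : E} (hc : c ∈ ⋂ i, C i) :
    IsConsistentErrorBound C (errorModulus C c) where
  nonneg _ _ ha _ := ha.trans le_errorModulus
  monotone_left _ hb _ ha _ _ h := errorModulus_mono hc ha hb h le_rfl
  monotone_right _ ha _ hb _ _ h := errorModulus_mono hc ha hb le_rfl h
  tendsto_zero _ hb := tendsto_errorModulus hC hc hb
  zero_left _ hb := errorModulus_zero hC hc hb
  error_bound x := infDist_le_errorModulus hc (mem_nearlyFeasible_iSup x)

theorem corollary5p8 {E : Type*} [NormedAddCommGroup E] [InnerProductSpace ℝ E]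
    [FiniteDimensional ℝ E] (O : OMinimalStructure) (m : ℕ) (hm : 1 ≤ m) (C : Fin m → Set E)
    (hclosed : ∀ i, IsClosed (C i)) (hconvex : ∀ i, Convex ℝ (C i))
    (hdef : ∀ i, O.Definable (C i)) (hne : (⋂ i, C i).Nonempty) :
    (∃ Φ : ℝ → ℝ → ℝ, IsConsistentErrorBound C Φ ∧
      ∃ r₀ : ℝ, 0 < r₀ ∧ ∀ r : ℝ, r₀ ≤ r →
        ∃ ρ ∈ Icc (0 : ℝ) 1, RegularlyVaryingAtZero (fun a => Φ a r) 1 ρ) ∧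
    (∀ B : Set E, Bornology.IsBounded B →
      ∃ ψ : ℝ → ℝ, (∀ t, 0 ≤ t → 0 ≤ ψ t) ∧ MonotoneOn ψ (Ici 0) ∧
        (∃ ρ ∈ Icc (0 : ℝ) 1, RegularlyVaryingAtZero ψ 1 ρ) ∧
        Tendsto ψ (𝓝[>] 0) (𝓝 0) ∧
        ∀ x ∈ B, Metric.infDist x (⋂ i, C i) ≤ ψ (⨆ i, Metric.infDist x (C i))) := by
  obtain ⟨c, hc⟩ := hne
  have hΦ := isConsistentErrorBound_errorModulus hclosed hc
  have hrv : ∀ r : ℝ, 0 ≤ r →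
      ∃ ρ ∈ Icc (0 : ℝ) 1, RegularlyVaryingAtZero (fun a => errorModulus C c a r) 1 ρ := fun r hr =>
    exists_regularlyVaryingAtZero (fun t ht => ht.trans_le le_errorModulus)
      ((hΦ.monotone_left r hr).mono Ioi_subset_Ici_self)
      (fun t l ht hl hl1 => mul_errorModulus_le hclosed hconvex hc ht hr hl hl1)
      (fun l k hl hk => eventually_mul_errorModulus_le_or hdef hclosed hc hr hl hk)
  -- Every radius `r ≥ 0` works, so the threshold `1` is arbitrary.
  refine ⟨⟨_, hΦ, 1, one_pos, fun r hr => hrv r (zero_le_one.trans hr)⟩, fun B hB => ?_⟩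
  obtain ⟨r, hr, hBr⟩ := hB.exists_pos_norm_le
  refine ⟨fun a => errorModulus C c a r, fun t ht => hΦ.nonneg t r ht hr.le,
    hΦ.monotone_left r hr.le, hrv r hr.le, hΦ.tendsto_zero r hr.le, fun x hx => ?_⟩
  exact (hΦ.error_bound x).trans (hΦ.monotone_right _
    (Real.iSup_nonneg fun i => Metric.infDist_nonneg) (norm_nonneg x) hr.le (hBr x hx))
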